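/- Let $k$ be a field and let $(W,S)$ be a finite Coxeter system with set of reflections $T=\{wsw^{-1} : w\in W,\ s\in S\}$. Let $\ell_T(w)$ be the least number of reflections whose product is $w$, and let $w\leq_T z$ mean $\ell_T(w)+\ell_T(w^{-1}z)=\ell_T(z)$. Let $c$ be a standard Coxeter element, i.e. the product of all elements of $S$, each taken once, in some order. Put $NC_2=\{w\in W : w\leq_T c,\ \ell_T(w)=2\}$ and $T(w)=\{t\in T : t\leq_T w\}$. For $t,u\in T$ write $t^u=u^{-1}tu$. A rank 2 parabolic subgroup is a subgroup $P=x\langle s,s'\rangle x^{-1}$ with $x\in W$ and $s\neq s'$ in $S$; its simple reflections are those relative to the positive roots of $W$ lying in the root system of $P$. The reflections of $P$ can be indexed as $P\cap T=\{u_1,\dots,u_m\}$ so that $u_{i+1}u_i=u_iu_{i-1}$ for all $i$ (indices modulo $m$) and the simple reflections of $P$ are $u_1$ and $u_m$; such an indexing is unique up to reversal. A reflection ordering is a total order $\prec$ on $T$ such that for every such $P$ either $u_1\prec\dots\prec u_m$ or $u_m\prec\dots\prec u_1$. It is $c$-compatible if for every $w\in NC_2$, writing $T(w)=\{u_1\prec\dots\prec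 u_m\}$, one has $w=u_iu_{i-1}$ for $1\leq i\leq m$ (with $u_0=u_m$). Fix a $c$-compatible reflection ordering $\prec$ on $T$. Let $\mathbf{D}(W)$ be the dual braid monoid, the monoid with one generator $\mathbf{t}$ for each $t\in T$ and relations $\mathbf{t}\mathbf{u}=\mathbf{u}\,\mathbf{t}^{\mathbf{u}}$ whenever $tu\leq_T c$, where $\mathbf{t}^{\mathbf{u}}$ is the generator that corresponds to $t^u$. Let $\mathcal{A}(W)=k[\mathbf{D}(W)]$ be its monoid algebra. Let $k^{\mathbf{T}}$ be the vector space with basis $\{\mathbf{t} : t\in T\}$ and $\mathcal{T}(\cdot)$ the tensor algebra. Then $\mathcal{A}(W)=\mathcal{T}(k^{\mathbf{T}})/\langle R\rangle$, where $R\subset k^{\mathbf{T}}\otimes k^{\mathbf{T}}$ is spanned by the elements $\mathbf{t}\otimes\mathbf{u}-\mathbf{u}\otimes\mathbf{t}^{\mathbf{u}}$ with $tu\leq_T c$. Let $\mathcal{P}(W)=\mathcal{A}(W)^!$ be its quadratic dual, i.e. $\mathcal{P}(W)=\mathcal{T}((k^{\mathbf{T}})^*)/\langle R^\perp\rangle$,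 where $R^\perp\subset (k^{\mathbf{T}})^*\otimes(k^{\mathbf{T}})^*=(k^{\mathbf{T}}\otimes k^{\mathbf{T}})^*$ is the space of linear forms vanishing on $R$. Let $\{\mathbb{t} : t\in T\}$ be the basis of $(k^{\mathbf{T}})^*$ dual to $\{\mathbf{t} : t\in T\}$. Then $R^\perp$ is spanned by the elements 1. $\mathbb{t}\otimes\mathbb{t}$ for $t\in T$; 2. $\mathbb{t}\otimes\mathbb{u}$ for $t,u\in T$ such that $tu\not\leq_T c$; 3. $\mathbb{u}_1\otimes\mathbb{u}_m+\mathbb{u}_m\otimes\mathbb{u}_{m-1}+\cdots+\mathbb{u}_2\otimes\mathbb{u}_1$ for each $w\in NC_2$, where $T(w)=\{u_1\prec\dots\prec u_m\}$. Consequently $\mathcal{P}(W)$ is the algebra presented by the generators $\mathbb{t}$, $t\in T$, subject to the relations that set the elements in 1, 2 and 3 to zero. -/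

import Mathlib

open scoped TensorProduct

noncomputable section

namespace DualBraid

/-! ### Quadratic algebras and quadratic duals -/

section Quadratic

variable (k : Type*) [Field k]

/-- The embedding of `V ⊗ V` in the tensor algebra as the component of degree two. -/
def degreeTwo (V : Type*) [AddCommGroup V] [Module k V] : V ⊗[k] V →ₗ[k] TensorAlgebra k V :=
  TensorProduct.lift
    ((LinearMap.mul k (TensorAlgebra k V)).compl₁₂ (TensorAlgebra.ι k) (TensorAlgebra.ι k))

/-- The relations that set to zero the elements of `R ⊆ V ⊗ V` inside the tensor algebra. -/
def QuadraticRel {V : Type*} [AddCommGroup V] [Module k V] (R : Submodule k (V ⊗[k] V))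
    (x y : TensorAlgebra k V) : Prop :=
  ∃ r ∈ R, x = degreeTwo k V r ∧ y = 0

/-- The quadratic algebra `T(V) / ⟨R⟩`, the quotient of the tensor algebra by the two-sided ideal
generated by `R ⊆ V ⊗ V`. -/
abbrev QuadAlg {V : Type*} [AddCommGroup V] [Module k V] (R : Submodule k (V ⊗[k] V)) : Type _ :=
  RingQuot (QuadraticRel k R)

/-- The canonical map from `V` to `T(V) / ⟨R⟩`. -/
def QuadAlg.gen {V : Type*} [AddCommGroup V] [Module k V] (R : Submodule k (V ⊗[k] V)) :
    V →ₗ[k] QuadAlg k R :=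
  (RingQuot.mkAlgHom k (QuadraticRel k R)).toLinearMap ∘ₗ TensorAlgebra.ι k

/-- The orthogonal `R^⊥ ⊆ V* ⊗ V*` of `R ⊆ V ⊗ V`: an element of `V* ⊗ V*` is seen as a linear form
on `V ⊗ V` by `(f ⊗ g) (x ⊗ y) = f x * g y`, and it is in `R^⊥` if this form vanishes on `R`. -/
def orthogonal {V : Type*} [AddCommGroup V] [Module k V] (R : Submodule k (V ⊗[k] V)) :
    Submodule k (Module.Dual k V ⊗[k] Module.Dual k V) :=
  R.dualAnnihilator.comap (TensorProduct.dualDistrib k V V)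

/-- A quadratic presentation `A ≃ T(V) / ⟨R⟩` of an algebra `A`, with `V` finite-dimensional and
`R ⊆ V ⊗ V`. -/
structure QuadraticPresentation (A : Type*) [Ring A] [Algebra k A]
    (V : Type*) [AddCommGroup V] [Module k V] [Module.Finite k V] where
  rel : Submodule k (V ⊗[k] V)
  equiv : QuadAlg k rel ≃ₐ[k] A

/-- The quadratic dual `T(V*) / ⟨R^⊥⟩` of an algebra presented as `T(V) / ⟨R⟩`. -/
abbrev QuadraticPresentation.Dual {k : Type*} [Field k] {A : Type*} [Ring A] [Algebra k A]
    {V : Type*} [AddCommGroup V] [Module k V] [Module.Finite k V]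
    (Q : QuadraticPresentation k A V) : Type _ :=
  QuadAlg k (orthogonal k Q.rel)

end Quadratic

/-! ### Reflections, absolute order, noncrossing partitions -/

section Coxeter

variable {B W : Type*} [Group W] {M : CoxeterMatrix B} (cs : CoxeterSystem M W)

/-- The set `T` of reflections, as a type. -/
abbrev Refl : Type _ := {t : W // cs.IsReflection t}

/-- The conjugate `t ^ u = u⁻¹ t u`. -/
def Refl.conj {cs : CoxeterSystem M W} (t u : Refl cs) : Refl cs :=
  ⟨u.1⁻¹ * t.1 * u.1, by simpa using t.2.conj u.1⁻¹⟩

/-- The reflection length `ℓ_T`. The set is never empty, because `T` generates `W`. -/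
def reflLength (w : W) : ℕ :=
  sInf {n | ∃ l : List (Refl cs), l.length = n ∧ (l.map Subtype.val).prod = w}

/-- The absolute order `≤_T`. -/
def AbsLE (w z : W) : Prop :=
  reflLength cs w + reflLength cs (w⁻¹ * z) = reflLength cs z

/-- A standard Coxeter element: the product of all simple reflections, each of them taken once, in
some order. -/
def IsStandardCoxeterElement (c : W) : Prop :=
  ∃ l : List B, l.Nodup ∧ (∀ i, i ∈ l) ∧ cs.wordProd l = c

/-- `NC_j(W, c)`: the elements of rank `j` of the interval `[e, c]` of the absolute order. -/
def NC (c : W) (j : ℕ) : Set W := {w | AbsLE cs w c ∧ reflLength cs w = j}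

/-- `T(w)`: the reflections below `w` for the absolute order. -/
def reflBelow (w : W) : Set (Refl cs) := {t | AbsLE cs t.1 w}

/-! ### Reflection orderings -/

/-- A parabolic subgroup of rank 2: a conjugate of a subgroup generated by two distinct simple
reflections. -/
def IsRankTwoParabolic (P : Subgroup W) : Prop :=
  ∃ (x : W) (i j : B), i ≠ j ∧
    P = (Subgroup.closure {cs.simple i, cs.simple j}).map (MulAut.conj x).toMonoidHom

/-- `t` is a simple reflection of the reflection subgroup `P`, for the positive roots of `P` that
are positive roots of `W`. The left inversions of `t` are the reflections whose positive root
becomes negative under `t`, and a reflection of `P` is simple exactly if the only positive root of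
`P` that it makes negative is its own (Dyer's canonical generators of `P`). -/
def IsSimpleIn (P : Subgroup W) (t : Refl cs) : Prop :=
  t.1 ∈ P ∧ ∀ t' : Refl cs, t'.1 ∈ P → cs.IsLeftInversion t.1 t'.1 → t' = t

/-- A valid indexing `u_1, …, u_m` (here `u 0, …, u (Fin.last n)`, with `m = n + 1`) of the
reflections of a parabolic subgroup `P` of rank 2: `u_{i+1} u_i = u_i u_{i-1}` with indices modulo
`m`, and the simple reflections of `P` are `u_1` and `u_m`. The permutation `finRotate` is
`i ↦ i + 1` modulo `m`. -/
def IsRankTwoIndexing (P : Subgroup W) {n : ℕ} (u : Fin (n + 1) → Refl cs) : Prop :=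
  Function.Injective u ∧ Set.range u = {t | t.1 ∈ P} ∧
  (∀ i, (u (finRotate _ (finRotate _ i))).1 * (u (finRotate _ i)).1
    = (u (finRotate _ i)).1 * (u i).1) ∧
  {t | IsSimpleIn cs P t} = {u 0, u (Fin.last n)}

/-- A reflection ordering: a (strict) total order on `T` for which the reflections of each parabolic
subgroup of rank 2 appear in the order of a valid indexing or in the reverse order. -/
def IsReflectionOrdering (prec : Refl cs → Refl cs → Prop) : Prop :=
  IsStrictTotalOrder (Refl cs) prec ∧
  ∀ P : Subgroup W, IsRankTwoParabolic cs P →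
    ∀ (n : ℕ) (u : Fin (n + 1) → Refl cs), IsRankTwoIndexing cs P u →
      (∀ i j, i < j → prec (u i) (u j)) ∨ (∀ i j, i < j → prec (u j) (u i))

/-- `u` lists the elements of `T(w)` in increasing order: `T(w) = {u_1 ≺ … ≺ u_m}`. -/
def IsIncreasingListing (prec : Refl cs → Refl cs → Prop) (w : W) {m : ℕ}
    (u : Fin m → Refl cs) : Prop :=
  (∀ i j, i < j → prec (u i) (u j)) ∧ Set.range u = reflBelow cs w

/-- A reflection ordering is compatible with `c` if for each `w ∈ NC_2` with
`T(w) = {u_1 ≺ … ≺ u_m}` we have `w = u_{i+1} u_i` for all `i`, with indices modulo `m`. -/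
def IsCompatibleReflectionOrdering (c : W) (prec : Refl cs → Refl cs → Prop) : Prop :=
  IsReflectionOrdering cs prec ∧
  ∀ w ∈ NC cs c 2, ∀ (m : ℕ) (u : Fin m → Refl cs), IsIncreasingListing cs prec w u →
    ∀ i, w = (u (finRotate m i)).1 * (u i).1

/-! ### The dual braid monoid, its algebra and the dual algebra -/

/-- The defining relations `t u = u t^u`, for `t u ≤_T c`. -/
inductive BraidRel (c : W) : FreeMonoid (Refl cs) → FreeMonoid (Refl cs) → Prop
  | mk (t u : Refl cs) (h : AbsLE cs (t.1 * u.1) c) :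
      BraidRel c (FreeMonoid.of t * FreeMonoid.of u) (FreeMonoid.of u * FreeMonoid.of (t.conj u))

/-- The dual braid monoid `D(W)`. -/
abbrev DualBraidMonoid (c : W) : Type _ := PresentedMonoid (BraidRel cs c)

variable (k : Type*) [Field k]

/-- The algebra `A(W) = k[D(W)]`. -/
abbrev DualBraidAlgebra (c : W) : Type _ := MonoidAlgebra k (DualBraidMonoid cs c)

/-- The span of the elements `t ⊗ u - u ⊗ t^u`, for `t u ≤_T c`. -/
def braidRelations (c : W) : Submodule k ((Refl cs →₀ k) ⊗[k] (Refl cs →₀ k)) :=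
  Submodule.span k {x | ∃ t u : Refl cs, AbsLE cs (t.1 * u.1) c ∧
    x = Finsupp.single t 1 ⊗ₜ[k] Finsupp.single u 1
      - Finsupp.single u 1 ⊗ₜ[k] Finsupp.single (t.conj u) 1}

@[simp] theorem degreeTwo_tmul {V : Type*} [AddCommGroup V] [Module k V] (x y : V) :
    degreeTwo k V (x ⊗ₜ[k] y) = TensorAlgebra.ι k x * TensorAlgebra.ι k y := rfl

/-- The map `T(k^T) → k[D(W)]` that sends each generator to itself. -/
def toDualBraidAlgebra (c : W) : TensorAlgebra k (Refl cs →₀ k) →ₐ[k] DualBraidAlgebra cs k c :=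
  TensorAlgebra.lift k (Finsupp.lift _ k _ fun t =>
    MonoidAlgebra.of k (DualBraidMonoid cs c) (PresentedMonoid.of (BraidRel cs c) t))

@[simp] theorem toDualBraidAlgebra_ι (c : W) (t : Refl cs) :
    toDualBraidAlgebra cs k c (TensorAlgebra.ι k (Finsupp.single t 1)) =
      MonoidAlgebra.of k (DualBraidMonoid cs c) (PresentedMonoid.of (BraidRel cs c) t) := by
  simp [toDualBraidAlgebra]

theorem of_mul_of (c : W) (t u : Refl cs) (h : AbsLE cs (t.1 * u.1) c) :
    PresentedMonoid.of (BraidRel cs c) t * PresentedMonoid.of (BraidRel cs c) u =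
      PresentedMonoid.of (BraidRel cs c) u * PresentedMonoid.of (BraidRel cs c) (t.conj u) :=
  PresentedMonoid.mk_eq_mk_of_rel (BraidRel.mk t u h)

theorem toDualBraidAlgebra_rel (c : W) ⦃x y : TensorAlgebra k (Refl cs →₀ k)⦄
    (h : QuadraticRel k (braidRelations cs k c) x y) :
    toDualBraidAlgebra cs k c x = toDualBraidAlgebra cs k c y := by
  obtain ⟨r, hr, rfl, rfl⟩ := h
  rw [map_zero]
  have : braidRelations cs k c ≤ LinearMap.ker
      ((toDualBraidAlgebra cs k c).toLinearMap ∘ₗ degreeTwo k (Refl cs →₀ k)) := by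
    refine Submodule.span_le.2 ?_
    rintro _ ⟨t, u, h, rfl⟩
    simp only [SetLike.mem_coe, LinearMap.mem_ker, LinearMap.comp_apply, map_sub,
      AlgHom.toLinearMap_apply, degreeTwo_tmul, map_mul, toDualBraidAlgebra_ι]
    rw [← map_mul, ← map_mul, of_mul_of cs c t u h, sub_self]
  exact LinearMap.mem_ker.1 (this hr)

theorem gen_mul_gen (c : W) (t u : Refl cs) (h : AbsLE cs (t.1 * u.1) c) :
    QuadAlg.gen k (braidRelations cs k c) (Finsupp.single t 1)
        * QuadAlg.gen k (braidRelations cs k c) (Finsupp.single u 1) =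
      QuadAlg.gen k (braidRelations cs k c) (Finsupp.single u 1)
        * QuadAlg.gen k (braidRelations cs k c) (Finsupp.single (t.conj u) 1) := by
  have := RingQuot.mkAlgHom_rel k (s := QuadraticRel k (braidRelations cs k c))
    ⟨_, Submodule.subset_span ⟨t, u, h, rfl⟩, rfl, rfl⟩
  rw [map_sub, map_sub, map_zero, sub_eq_zero, degreeTwo_tmul, degreeTwo_tmul, map_mul,
    map_mul] at this
  exact this

/-- The map `D(W) → T(k^T) / ⟨R⟩` that sends each generator to itself. -/
def ofDualBraidMonoid (c : W) : DualBraidMonoid cs c →* QuadAlg k (braidRelations cs k c) :=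
  PresentedMonoid.lift
    (fun t => QuadAlg.gen k (braidRelations cs k c) (Finsupp.single t 1)) (by
      rintro _ _ ⟨t, u, h⟩
      simpa using gen_mul_gen cs k c t u h)

/-- The isomorphism `T(k^T) / ⟨R⟩ ≃ k[D(W)]`, the identity on the generators. -/
def dualBraidAlgebraEquiv (c : W) :
    QuadAlg k (braidRelations cs k c) ≃ₐ[k] DualBraidAlgebra cs k c :=
  AlgEquiv.ofAlgHom
    (RingQuot.liftAlgHom k ⟨toDualBraidAlgebra cs k c, toDualBraidAlgebra_rel cs k c⟩)
    (MonoidAlgebra.lift k _ _ (ofDualBraidMonoid cs k c))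
    (by
      refine MonoidAlgebra.algHom_ext' (PresentedMonoid.ext (BraidRel cs c) fun t => ?_)
        (Subsingleton.elim _ _)
      simp [ofDualBraidMonoid, QuadAlg.gen])
    (by
      refine RingQuot.ringQuot_ext' _ _ _ ?_
      refine TensorAlgebra.hom_ext ?_
      refine Finsupp.lhom_ext' fun t => LinearMap.ext_ring ?_
      simp [ofDualBraidMonoid, QuadAlg.gen])

/-- The presentation of `A(W)` as a quadratic algebra, with generators `T`. -/
def dualBraidPresentation [Finite W] (c : W) :
    QuadraticPresentation k (DualBraidAlgebra cs k c) (Refl cs →₀ k) where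
  rel := braidRelations cs k c
  equiv := dualBraidAlgebraEquiv cs k c

/-- The dual algebra `P(W)`: the quadratic dual of `A(W)`. -/
abbrev DualAlgebra [Finite W] (c : W) : Type _ := (dualBraidPresentation cs k c).Dual

/-- The three families of relations of the dual algebra, written with elements `b t`, `t ∈ T`, of a
vector space. -/
def dualRelations (c : W) (prec : Refl cs → Refl cs → Prop)
    {E : Type*} [AddCommGroup E] [Module k E] (b : Refl cs → E) : Submodule k (E ⊗[k] E) :=
  Submodule.span k
    ({x | ∃ t : Refl cs, x = b t ⊗ₜ[k] b t} ∪
     {x | ∃ t u : Refl cs, ¬ AbsLE cs (t.1 * u.1) c ∧ x = b t ⊗ₜ[k] b u} ∪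
     {x | ∃ w ∈ NC cs c 2, ∃ (m : ℕ) (u : Fin m → Refl cs), IsIncreasingListing cs prec w u ∧
        x = ∑ i : Fin m, b (u (finRotate m i)) ⊗ₜ[k] b (u i)})

end Coxeter

end DualBraid

end

open DualBraid

open scoped TensorProduct

noncomputable section

namespace DualBraid

/-! ### Isomorphisms of quadratic algebras -/

section QuadAlgMap

variable (k : Type*) [Field k] {V V' : Type*} [AddCommGroup V] [Module k V]
  [AddCommGroup V'] [Module k V']

/-! Write an element of `V* ⊗ V*` as a sum of `a(t,u) t* ⊗ u*`. It kills the braid relations exactly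
when `a(t,u) = a(u, t^u)` whenever `tu ≤_T c` (`mem_orthogonal_braidRelations`). Since `tu = u t^u`,
the move `(t,u) ↦ (u, t^u)` preserves products, so the problem splits over the fibres of `(t,u) ↦
tu`. A fibre over `w` not below `c` carries no condition and is spanned by relations of type 2. A
diagonal pair `(t,t)` is fixed by the move and gives type 1. In the remaining case `w ∈ NC_2`, and
compatibility says that the fibre is `{(u_{i+1}, u_i)}`, on which the move acts as a single cycle.
Thus `a` is constant there and only the cyclic sum survives, which is type 3
(`sum_fiber_mem_dualRelations`). The converse inclusion is `dualRelations_le_orthogonal`. The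
presentation follows by carrying the relations along the dual basis (`map_dualRelations`,
`QuadAlg.congr`). -/

theorem map_degreeTwo (f : V →ₗ[k] V') (x : V ⊗[k] V) :
    TensorAlgebra.lift k (TensorAlgebra.ι k ∘ₗ f) (degreeTwo k V x)
      = degreeTwo k V' (TensorProduct.map f f x) := by
  induction x with
  | zero => simp
  | tmul a b => simp
  | add a b ha hb => simp only [map_add, ha, hb]

/-- A linear map that sends the relations `R` to relations `R'` induces a map of quadratic
algebras. -/
def QuadAlg.map {R : Submodule k (V ⊗[k] V)} {R' : Submodule k (V' ⊗[k] V')} (f : V →ₗ[k] V')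
    (h : R.map (TensorProduct.map f f) ≤ R') : QuadAlg k R →ₐ[k] QuadAlg k R' :=
  RingQuot.liftAlgHom k ⟨(RingQuot.mkAlgHom k (QuadraticRel k R')).comp
    (TensorAlgebra.lift k (TensorAlgebra.ι k ∘ₗ f)), by
      rintro _ _ ⟨r, hr, rfl, rfl⟩
      rw [AlgHom.comp_apply, map_degreeTwo, map_zero]
      have := RingQuot.mkAlgHom_rel k (s := QuadraticRel k R')
        ⟨_, h (Submodule.mem_map_of_mem hr), rfl, rfl⟩
      rw [this, map_zero]⟩

theorem QuadAlg.map_gen {R : Submodule k (V ⊗[k] V)} {R' : Submodule k (V' ⊗[k] V')}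
    (f : V →ₗ[k] V') (h : R.map (TensorProduct.map f f) ≤ R') (x : V) :
    QuadAlg.map k f h (QuadAlg.gen k R x) = QuadAlg.gen k R' (f x) := by
  simp [QuadAlg.map, QuadAlg.gen]

theorem QuadAlg.hom_ext {R : Submodule k (V ⊗[k] V)} {A : Type*} [Semiring A] [Algebra k A]
    {f g : QuadAlg k R →ₐ[k] A} (h : ∀ x, f (QuadAlg.gen k R x) = g (QuadAlg.gen k R x)) :
    f = g :=
  RingQuot.ringQuot_ext' _ _ _ (TensorAlgebra.hom_ext (LinearMap.ext h))

/-- A linear isomorphism that matches the relations induces an isomorphism of quadratic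
algebras. -/
def QuadAlg.congr {R : Submodule k (V ⊗[k] V)} {R' : Submodule k (V' ⊗[k] V')} (e : V ≃ₗ[k] V')
    (h : R.map (TensorProduct.map e.toLinearMap e.toLinearMap) = R') :
    QuadAlg k R ≃ₐ[k] QuadAlg k R' :=
  AlgEquiv.ofAlgHom (QuadAlg.map k e.toLinearMap h.le)
    (QuadAlg.map k (R := R') (R' := R) e.symm.toLinearMap (by
      rw [← h, ← Submodule.map_comp, ← TensorProduct.map_comp]
      simp))
    (QuadAlg.hom_ext k fun x => by simp [QuadAlg.map_gen])
    (QuadAlg.hom_ext k fun x => by simp [QuadAlg.map_gen])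

theorem QuadAlg.congr_gen {R : Submodule k (V ⊗[k] V)} {R' : Submodule k (V' ⊗[k] V')}
    (e : V ≃ₗ[k] V') (h : R.map (TensorProduct.map e.toLinearMap e.toLinearMap) = R') (x : V) :
    QuadAlg.congr k e h (QuadAlg.gen k R x) = QuadAlg.gen k R' (e x) :=
  QuadAlg.map_gen k e.toLinearMap h.le x

end QuadAlgMap

/-! ### Reflection length of products of at most two reflections -/

section ReflLength

variable {B W : Type*} [Group W] {M : CoxeterMatrix B} (cs : CoxeterSystem M W)

theorem reflLength_prod_le (l : List (Refl cs)) :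
    reflLength cs (l.map Subtype.val).prod ≤ l.length :=
  Nat.sInf_le ⟨l, rfl, rfl⟩

/-- The infimum is attained because the given list already witnesses that the set of lengths is
nonempty. -/
theorem exists_list_reflLength_prod (l : List (Refl cs)) :
    ∃ l' : List (Refl cs), l'.length = reflLength cs (l.map Subtype.val).prod ∧
      (l'.map Subtype.val).prod = (l.map Subtype.val).prod :=
  Nat.sInf_mem (s := {n | ∃ l' : List (Refl cs), l'.length = n ∧
    (l'.map Subtype.val).prod = (l.map Subtype.val).prod}) ⟨_, l, rfl, rfl⟩

theorem lengthParity_refl (t : Refl cs) : cs.lengthParity t.1 = Multiplicative.ofAdd 1 := by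
  rw [cs.lengthParity_eq_ofAdd_length, (ZMod.natCast_eq_one_iff_odd).2 t.2.odd_length]

theorem lengthParity_list_prod (l : List (Refl cs)) :
    cs.lengthParity (l.map Subtype.val).prod = Multiplicative.ofAdd (l.length : ZMod 2) := by
  induction l with
  | nil => simp
  | cons t l ih =>
    rw [List.map_cons, List.prod_cons, map_mul, ih, lengthParity_refl, ← ofAdd_add,
      List.length_cons, Nat.cast_succ, add_comm]

/-- The sign character sends every reflection to the nontrivial element, so all factorizations of
one element into reflections have lengths of the same parity. -/
theorem reflLength_prod_modEq (l : List (Refl cs)) :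
    reflLength cs (l.map Subtype.val).prod ≡ l.length [MOD 2] := by
  obtain ⟨l', hl', h⟩ := exists_list_reflLength_prod cs l
  rw [← hl', ← ZMod.natCast_eq_natCast_iff]
  have := congrArg cs.lengthParity h
  rw [lengthParity_list_prod, lengthParity_list_prod] at this
  exact Multiplicative.ofAdd.injective this

theorem reflLength_refl (t : Refl cs) : reflLength cs t.1 = 1 := by
  have h₁ := reflLength_prod_le cs [t]
  have h₂ := reflLength_prod_modEq cs [t]
  simp only [List.map_cons, List.map_nil, List.prod_singleton, List.length_singleton,
    Nat.ModEq] at h₁ h₂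
  omega

theorem reflLength_mul_of_ne {t u : Refl cs} (h : t ≠ u) : reflLength cs (t.1 * u.1) = 2 := by
  have h₁ := reflLength_prod_le cs [t, u]
  have h₂ := reflLength_prod_modEq cs [t, u]
  obtain ⟨l, hl, hw⟩ := exists_list_reflLength_prod cs [t, u]
  simp only [List.map_cons, List.map_nil, List.prod_cons, List.prod_nil, mul_one,
    List.length_cons, List.length_nil, Nat.ModEq] at h₁ h₂ hl hw
  -- The length is even and at most 2, so it suffices to exclude 0, that is `tu = 1`, which would
  -- force `t = u`.
  have h₀ : reflLength cs (t.1 * u.1) ≠ 0 := fun h₀ => by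
    rw [h₀, List.length_eq_zero_iff] at hl
    subst hl
    refine h (Subtype.ext ?_)
    rw [← u.2.inv]
    exact eq_inv_of_mul_eq_one_left hw.symm
  omega

theorem mul_conj (t u : Refl cs) : u.1 * (t.conj u).1 = t.1 * u.1 := by
  simp [Refl.conj, mul_assoc]

/-- The complement of `u` in `tu` is the reflection `t^u`, so the lengths add up as 1 + 1 = 2. -/
theorem right_mem_reflBelow_mul {t u : Refl cs} (h : t ≠ u) :
    u ∈ reflBelow cs (t.1 * u.1) := by
  have : u.1⁻¹ * (t.1 * u.1) = (t.conj u).1 := by simp [Refl.conj, mul_assoc]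
  simp only [reflBelow, AbsLE, Set.mem_ofPred_eq, this, reflLength_refl,
    reflLength_mul_of_ne cs h]

theorem exists_increasingListing [Finite W] (prec : Refl cs → Refl cs → Prop)
    (h : IsStrictTotalOrder (Refl cs) prec) (w : W) :
    ∃ (m : ℕ) (u : Fin m → Refl cs), IsIncreasingListing cs prec w u := by
  classical
  let := linearOrderOfSTO prec
  let s : Finset (Refl cs) := (Set.toFinite (reflBelow cs w)).toFinset
  refine ⟨s.card, s.orderEmbOfFin rfl, fun i j hij => (s.orderEmbOfFin rfl).strictMono hij, ?_⟩
  rw [Finset.range_orderEmbOfFin, Set.Finite.coe_toFinset]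

theorem IsIncreasingListing.injective {cs : CoxeterSystem M W} {prec : Refl cs → Refl cs → Prop}
    (h : IsStrictTotalOrder (Refl cs) prec) {w : W} {m : ℕ} {u : Fin m → Refl cs}
    (hu : IsIncreasingListing cs prec w u) : Function.Injective u := by
  intro i j hij
  by_contra hne
  rcases lt_or_gt_of_ne hne with hlt | hlt
  · exact irrefl_of prec (u j) (hij ▸ hu.1 i j hlt)
  · exact irrefl_of prec (u j) (hij ▸ hu.1 j i hlt)

end ReflLength

/-- Rotation is transitive on indices. The steps from `i` to `i + 1` without wrapping already link
every index to 0. -/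
theorem eq_of_finRotate_invariant {α : Type*} {m : ℕ} (f : Fin m → α)
    (h : ∀ i, f (finRotate m i) = f i) (i j : Fin m) : f i = f j := by
  cases m with
  | zero => exact i.elim0
  | succ n =>
    have key : ∀ i, f i = f 0 := fun i => by
      induction i using Fin.induction with
      | zero => rfl
      | succ i ih => rw [← ih, ← h i.castSucc, finRotate_apply, Fin.coeSucc_eq_succ]
    rw [key i, key j]

/-! ### The orthogonal of the braid relations -/

section Orthogonal

variable (k : Type*) [Field k]

/-- The basis of `(k^T)^*` dual to the standard basis of `k^T`, as an isomorphism. -/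
def dualEquiv (T : Type*) [Finite T] : (T →₀ k) ≃ₗ[k] Module.Dual k (T →₀ k) := by
  classical exact (Finsupp.basisSingleOne (R := k) (ι := T)).toDualEquiv

theorem dualEquiv_single {T : Type*} [Finite T] (t : T) :
    dualEquiv k T (Finsupp.single t 1) = Finsupp.lapply t := by
  classical
  refine Finsupp.lhom_ext' fun u => LinearMap.ext_ring ?_
  have := (Finsupp.basisSingleOne (R := k) (ι := T)).toDual_apply t u
  simp only [Finsupp.coe_basisSingleOne] at this
  simp [dualEquiv, this, Finsupp.single_apply, eq_comm]

/-- The coefficient of `t ⊗ u` in an element of `(k^T)^* ⊗ (k^T)^*`. -/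
def coeff {T : Type*} (t u : T) :
    Module.Dual k (T →₀ k) ⊗[k] Module.Dual k (T →₀ k) →ₗ[k] k :=
  (LinearMap.applyₗ (Finsupp.single t 1 ⊗ₜ[k] Finsupp.single u 1)) ∘ₗ
    TensorProduct.dualDistrib k (T →₀ k) (T →₀ k)

theorem coeff_tmul {T : Type*} (t u : T) (f g : Module.Dual k (T →₀ k)) :
    coeff k t u (f ⊗ₜ[k] g) = f (Finsupp.single t 1) * g (Finsupp.single u 1) := by
  simp [coeff]

theorem dual_eq_sum {T : Type*} [Fintype T] (f : Module.Dual k (T →₀ k)) :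
    f = ∑ t, f (Finsupp.single t 1) • (Finsupp.lapply t : Module.Dual k (T →₀ k)) := by
  classical
  refine Finsupp.lhom_ext' fun u => LinearMap.ext_ring ?_
  simp [Finsupp.single_apply]

theorem eq_sum_coeff {T : Type*} [Fintype T]
    (x : Module.Dual k (T →₀ k) ⊗[k] Module.Dual k (T →₀ k)) :
    x = ∑ p : T × T, coeff k p.1 p.2 x •
      ((Finsupp.lapply p.1 : Module.Dual k (T →₀ k)) ⊗ₜ[k]
        (Finsupp.lapply p.2 : Module.Dual k (T →₀ k))) := by
  induction x with
  | zero => simp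
  | tmul f g =>
    conv_lhs => rw [dual_eq_sum k f, dual_eq_sum k g]
    simp only [TensorProduct.sum_tmul, TensorProduct.tmul_sum, TensorProduct.smul_tmul_smul,
      coeff_tmul, Fintype.sum_prod_type]
    exact Finset.sum_comm
  | add x y hx hy =>
    simp only [map_add, add_smul, Finset.sum_add_distrib]
    rw [← hx, ← hy]

variable {B W : Type*} [Group W] {M : CoxeterMatrix B} (cs : CoxeterSystem M W) (c : W)

theorem mem_orthogonal_braidRelations
    (x : Module.Dual k (Refl cs →₀ k) ⊗[k] Module.Dual k (Refl cs →₀ k)) :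
    x ∈ orthogonal k (braidRelations cs k c) ↔
      ∀ t u : Refl cs, AbsLE cs (t.1 * u.1) c → coeff k t u x = coeff k u (t.conj u) x := by
  rw [orthogonal, Submodule.mem_comap, Submodule.mem_dualAnnihilator]
  constructor
  · intro h t u htu
    have := h _ (Submodule.subset_span ⟨t, u, htu, rfl⟩)
    rwa [map_sub, sub_eq_zero] at this
  · intro h r hr
    have : braidRelations cs k c ≤ LinearMap.ker (TensorProduct.dualDistrib k _ _ x) := by
      refine Submodule.span_le.2 ?_
      rintro _ ⟨t, u, htu, rfl⟩
      rw [SetLike.mem_coe, LinearMap.mem_ker, map_sub, sub_eq_zero]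
      exact h t u htu
    exact this hr

variable {cs c} {prec : Refl cs → Refl cs → Prop}

theorem dualRelations_le_orthogonal (hprec : IsCompatibleReflectionOrdering cs c prec) :
    dualRelations cs k c prec (fun t => (Finsupp.lapply t : Module.Dual k (Refl cs →₀ k)))
      ≤ orthogonal k (braidRelations cs k c) := by
  classical
  refine Submodule.span_le.2 ?_
  rintro _ ((⟨s, rfl⟩ | ⟨s, s', hs, rfl⟩) | ⟨w, hw, m, v, hv, rfl⟩) <;>
    refine (mem_orthogonal_braidRelations k cs c _).2 fun t u htu => ?_
  -- Type 1: the move fixes the diagonal pair `(s,s)` and sends no other pair to it.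
  · have key : (t = s ∧ u = s) ↔ (u = s ∧ t.conj u = s) := by
      constructor
      · rintro ⟨rfl, rfl⟩
        exact ⟨rfl, Subtype.ext (by simp [Refl.conj])⟩
      · rintro ⟨rfl, h⟩
        have := mul_conj cs t u
        rw [h] at this
        exact ⟨Subtype.ext (mul_right_cancel this).symm, rfl⟩
    simp only [coeff_tmul, Finsupp.lapply_apply, Finsupp.single_apply, ← ite_and, mul_ite, mul_one,
      mul_zero]
    exact if_congr (by tauto) rfl rfl
  · simp only [coeff_tmul, Finsupp.lapply_apply, Finsupp.single_apply, ← ite_and, mul_ite, mul_one,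
      mul_zero]
    -- Type 2: both pairs have a product below `c`, so neither can be `(s,s')` and both coefficients
    -- vanish.
    rw [if_neg, if_neg]
    · rintro ⟨rfl, rfl⟩
      exact hs (by rwa [mul_conj])
    · rintro ⟨rfl, rfl⟩
      exact hs htu
  · simp only [map_sum, coeff_tmul, Finsupp.lapply_apply, Finsupp.single_apply]
    -- Type 3: shifting the index on the left aligns `(v_{i+2}, v_{i+1})` with its image `(v_{i+1},
    -- v_i)` under the move, and the sums then agree term by term.
    rw [← Equiv.sum_comp (finRotate m)]
    refine Finset.sum_congr rfl fun i _ => ?_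
    rw [mul_comm]
    by_cases hi : u = v (finRotate m i)
    · subst hi
      have key : t = v (finRotate m (finRotate m i)) ↔ t.conj (v (finRotate m i)) = v i := by
        have h₁ := hprec.2 w hw m v hv i
        rw [hprec.2 w hw m v hv (finRotate m i)] at h₁
        have h₂ := mul_conj cs t (v (finRotate m i))
        constructor
        · rintro rfl
          exact Subtype.ext (mul_left_cancel (h₂.trans h₁))
        · intro h
          rw [h] at h₂
          exact Subtype.ext (mul_right_cancel (h₂.symm.trans h₁.symm))
      simp only [key]
    · simp only [if_neg hi, zero_mul]

theorem sum_fiber_mem_dualRelations [Finite W] [Fintype (Refl cs)] [DecidableEq W]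
    (hprec : IsCompatibleReflectionOrdering cs c prec) {E : Type*} [AddCommGroup E] [Module k E]
    (b : Refl cs → E) (a : Refl cs → Refl cs → k)
    (ha : ∀ t u : Refl cs, AbsLE cs (t.1 * u.1) c → a t u = a u (t.conj u)) (w : W) :
    ∑ p : Refl cs × Refl cs with p.1.1 * p.2.1 = w, a p.1 p.2 • (b p.1 ⊗ₜ[k] b p.2)
      ∈ dualRelations cs k c prec b := by
  by_cases hw1 : ∃ t u : Refl cs, t.1 * u.1 = w ∧ t ≠ u ∧ AbsLE cs w c
  · obtain ⟨t₀, u₀, rfl, hne, hle⟩ := hw1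
    set w := t₀.1 * u₀.1 with hwdef
    have hw : w ∈ NC cs c 2 := ⟨hle, reflLength_mul_of_ne cs hne⟩
    obtain ⟨m, v, hv⟩ := exists_increasingListing cs prec hprec.1.1 w
    have hcomp := hprec.2 w hw m v hv
    have hsum : ∑ p : Refl cs × Refl cs with p.1.1 * p.2.1 = w, a p.1 p.2 • (b p.1 ⊗ₜ[k] b p.2)
        = ∑ i, a (v (finRotate m i)) (v i) • (b (v (finRotate m i)) ⊗ₜ[k] b (v i)) := by
      symm
      refine Finset.sum_bij (fun i _ => (v (finRotate m i), v i)) ?_ ?_ ?_ (fun _ _ => rfl)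
      · intro i _
        simpa using (hcomp i).symm
      · intro i _ j _ hij
        exact hv.injective hprec.1.1 (congrArg Prod.snd hij)
      -- Every factorization of `w` is listed: `u` lies in `T(w)`, hence is some `v_i`, and then `t
      -- = w u⁻¹` has to be the next reflection.
      · rintro ⟨t, u⟩ hp
        have hp : t.1 * u.1 = w := by simpa using hp
        have htu : t ≠ u := by
          rintro rfl
          refine hne (Subtype.ext ?_)
          rw [t.2.mul_self] at hp
          rw [← u₀.2.inv]
          exact eq_inv_of_mul_eq_one_left hp.symm
        have hu : u ∈ reflBelow cs w := hp ▸ right_mem_reflBelow_mul cs htu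
        rw [← hv.2] at hu
        obtain ⟨i, rfl⟩ := hu
        refine ⟨i, Finset.mem_univ i, Prod.ext (Subtype.ext ?_) rfl⟩
        exact mul_right_cancel ((hcomp i).symm.trans hp.symm)
    -- The move turns `(v_{i+2}, v_{i+1})` into `(v_{i+1}, v_i)`, so the coefficient is invariant
    -- under rotation.
    have hconst : ∀ i j, a (v (finRotate m i)) (v i) = a (v (finRotate m j)) (v j) := by
      refine eq_of_finRotate_invariant (fun i => a (v (finRotate m i)) (v i)) fun i => ?_
      rw [ha _ _ (hcomp (finRotate m i) ▸ hle)]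
      congr 1
      refine Subtype.ext (mul_left_cancel (a := (v (finRotate m i)).1) ?_)
      rw [mul_conj, ← hcomp, ← hcomp]
    rw [hsum]
    cases m with
    | zero => simp
    | succ n =>
      rw [Finset.sum_congr rfl fun i _ => by rw [hconst i 0], ← Finset.smul_sum]
      exact Submodule.smul_mem _ _ (Submodule.subset_span (Or.inr ⟨w, hw, _, v, hv, rfl⟩))
  -- Here each term is itself a multiple of a relation of type 1 or 2.
  · refine Submodule.sum_mem _ fun p hp => Submodule.smul_mem _ _ (Submodule.subset_span ?_)
    have hp : p.1.1 * p.2.1 = w := by simpa using hp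
    by_cases h : p.1 = p.2
    · exact Or.inl (Or.inl ⟨p.1, by rw [← h]⟩)
    · exact Or.inl (Or.inr ⟨p.1, p.2, fun hle => hw1 ⟨p.1, p.2, hp, h, hp ▸ hle⟩, rfl⟩)

theorem orthogonal_braidRelations [Finite W] (hprec : IsCompatibleReflectionOrdering cs c prec) :
    orthogonal k (braidRelations cs k c)
      = dualRelations cs k c prec
          (fun t => (Finsupp.lapply t : Module.Dual k (Refl cs →₀ k))) := by
  classical
  have := Fintype.ofFinite (Refl cs)
  have := Fintype.ofFinite W
  refine le_antisymm (fun x hx => ?_) (dualRelations_le_orthogonal k hprec)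
  rw [eq_sum_coeff k x,
    ← Finset.sum_fiberwise _ (fun p : Refl cs × Refl cs => p.1.1 * p.2.1)]
  exact Submodule.sum_mem _ fun w _ => sum_fiber_mem_dualRelations k hprec _
    (fun t u => coeff k t u x) ((mem_orthogonal_braidRelations k cs c x).1 hx) w

/-- The relations are natural in the vectors `b t`, which permits replacing the dual basis by free
generators. -/
theorem map_dualRelations {E E' : Type*} [AddCommGroup E] [Module k E] [AddCommGroup E']
    [Module k E'] (f : E →ₗ[k] E') (b : Refl cs → E) :
    (dualRelations cs k c prec b).map (TensorProduct.map f f)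
      = dualRelations cs k c prec (fun t => f (b t)) := by
  rw [dualRelations, dualRelations, Submodule.map_span]
  congr 1
  ext x
  constructor
  · rintro ⟨_, (⟨t, rfl⟩ | ⟨t, u, h, rfl⟩) | ⟨w, hw, m, u, hu, rfl⟩, rfl⟩
    · exact Or.inl (Or.inl ⟨t, rfl⟩)
    · exact Or.inl (Or.inr ⟨t, u, h, rfl⟩)
    · exact Or.inr ⟨w, hw, m, u, hu, by simp⟩
  · rintro ((⟨t, rfl⟩ | ⟨t, u, h, rfl⟩) | ⟨w, hw, m, u, hu, rfl⟩)
    · exact ⟨_, Or.inl (Or.inl ⟨t, rfl⟩), rfl⟩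
    · exact ⟨_, Or.inl (Or.inr ⟨t, u, h, rfl⟩), rfl⟩
    · exact ⟨_, Or.inr ⟨w, hw, m, u, hu, rfl⟩, by simp⟩

end Orthogonal

end DualBraid

end

theorem theorem5p1 {k : Type*} [Field k] {B W : Type*} [Group W] [Finite W]
    {M : CoxeterMatrix B} (cs : CoxeterSystem M W) (c : W)
    (hc : IsStandardCoxeterElement cs c) (prec : Refl cs → Refl cs → Prop)
    (hprec : IsCompatibleReflectionOrdering cs c prec) :
    orthogonal k (dualBraidPresentation cs k c).rel
        = dualRelations cs k c prec (fun t => (Finsupp.lapply t : Module.Dual k (Refl cs →₀ k))) ∧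
    ∃ Φ : QuadAlg k (dualRelations cs k c prec
          (fun t => (Finsupp.single t 1 : Refl cs →₀ k))) ≃ₐ[k] DualAlgebra cs k c,
      ∀ t : Refl cs,
        Φ (QuadAlg.gen k (dualRelations cs k c prec (fun t => Finsupp.single t 1))
            (Finsupp.single t 1))
          = QuadAlg.gen k (orthogonal k (dualBraidPresentation cs k c).rel)
              (Finsupp.lapply t : Module.Dual k (Refl cs →₀ k)) := by

  have h := orthogonal_braidRelations k hprec
  have hmap : (dualRelations cs k c prec (fun t => (Finsupp.single t 1 : Refl cs →₀ k))).map
      (TensorProduct.map (dualEquiv k (Refl cs)).toLinearMap (dualEquiv k (Refl cs)).toLinearMap)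
        = orthogonal k (braidRelations cs k c) := by
    rw [map_dualRelations, h]
    simp only [LinearEquiv.coe_coe, dualEquiv_single]
  refine ⟨h, QuadAlg.congr k (dualEquiv k (Refl cs)) hmap, fun t => ?_⟩
  exact (QuadAlg.congr_gen k _ hmap _).trans (by rw [dualEquiv_single]; rfl)
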